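/- Graphs are finite directed graphs, loops and multiple edges allowed. Walks are directed and may be empty; $O(p)$ and $T(p)$ denote the first and the last vertex of a walk $p$. A vertex $R$ of $G$ is a root if every vertex of $G$ can be reached by a walk from $R$; then $(G,R)$ is called a rooted graph. The unfolding tree $\mathcal T(G,R)$ is the set of walks in $G$ that start at $R$, ordered by: $p\le q$ if and only if $p$ is a prefix of $q$. A cofinite subspace of $\mathcal T(G,R)$ is a subset $\mathcal S$ with finite complement such that $p\in\mathcal S$ and $p\le q$ imply $q\in\mathcal S$; its basis is the set of its minimal elements. A representative is an isomorphism $\varphi:\mathcal S\to\mathcal S'$ of ordered sets between two cofinite subspaces; two representatives are equivalent if they agree on some cofinite subspace contained in both of their domains. Under composition (wherever it is defined) the equivalence classes form a group, the group of almost automorphisms of $\mathcal T(G,R)$. A representative $\varphi$ is a Higman–Thompson representative if, for every $b$ in the basis of its domain, $T(\varphi(b))=T(b)$ and $\varphi(bp)=\varphi(b)p$ for all walks $p$ starting at $T(b)$. The Higman–Thompson group $\mathcal{HT}(\mathcal T(G,R))$ is the subgroup of the classes that contain a Higman–Thompson representative. **Corollary 1.** Let $(G,R)$ be a finite rooted graph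 without sinks (every vertex has an outgoing edge), and let $M$ be a set of vertices of $G$ such that $R\in M$ and every nonempty cycle (closed walk) of $G$ contains a vertex in $M$. Let $G_M$ be the graph with vertex set $M$ whose edges are the nonempty walks $p$ in $G$ with $O(p),T(p)\in M$ such that no proper nonempty prefix of $p$ ends in $M$; as an edge of $G_M$, such a $p$ goes from $O(p)$ to $T(p)$. Then $R$ is a root of $G_M$, and $$\mathcal{HT}(\mathcal T(G,R))\cong\mathcal{HT}(\mathcal T(G_M,R))$$ as groups. -/

import Mathlib

universe u v

namespace HigmanThompson

/-! ### Almost automorphisms of a partially ordered set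

The trees below are ordered by the prefix order, the root being the least element. -/

section Order

variable {T : Type*} [PartialOrder T]

/-- A cofinite subspace: closed under passing to larger elements, with finite complement. -/
structure IsCofiniteSubspace (S : Set T) : Prop where
  isUpperSet : IsUpperSet S
  finite_compl : Sᶜ.Finite

theorem isCofiniteSubspace_univ : IsCofiniteSubspace (Set.univ : Set T) :=
  ⟨isUpperSet_univ, by simp⟩

theorem IsCofiniteSubspace.inter {S S' : Set T} (h : IsCofiniteSubspace S)
    (h' : IsCofiniteSubspace S') : IsCofiniteSubspace (S ∩ S') :=
  ⟨h.isUpperSet.inter h'.isUpperSet, by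
    rw [Set.compl_inter]; exact h.finite_compl.union h'.finite_compl⟩

/-- The basis of a cofinite subspace: its minimal elements. -/
def basis (S : Set T) : Set T := {b | Minimal (· ∈ S) b}

variable (T) in
/-- A representative of an almost automorphism: an isomorphism from the cofinite subspace `source`
onto the cofinite subspace `target` (the values outside `source` play no role). -/
structure Representative extends PartialEquiv T T where
  source_cofinite : IsCofiniteSubspace source
  target_cofinite : IsCofiniteSubspace target
  le_iff_le : ∀ x ∈ source, ∀ y ∈ source, toFun x ≤ toFun y ↔ x ≤ y

namespace Representative

instance : CoeFun (Representative T) (fun _ => T → T) := ⟨fun φ => φ.toPartialEquiv⟩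

/-- Pulling a cofinite subspace back along a representative. -/
theorem cofinite_preimage (φ : Representative T) {S : Set T} (hS : IsCofiniteSubspace S) :
    IsCofiniteSubspace (φ.source ∩ φ ⁻¹' S) := by
  refine ⟨fun x y hxy hx => ?_, ?_⟩
  · have hy := φ.source_cofinite.isUpperSet hxy hx.1
    exact ⟨hy, hS.isUpperSet ((φ.le_iff_le x hx.1 y hy).2 hxy) hx.2⟩
  · have h1 : (φ.source ∩ φ ⁻¹' Sᶜ).Finite := by
      refine Set.Finite.of_finite_image (f := φ) (hS.finite_compl.subset ?_) ?_
      · rintro _ ⟨x, hx, rfl⟩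
        exact hx.2
      · exact φ.toPartialEquiv.injOn.mono Set.inter_subset_left
    refine (φ.source_cofinite.finite_compl.union h1).subset fun x hx => ?_
    by_cases h : x ∈ φ.source
    · exact Or.inr ⟨h, fun h' => hx ⟨h, h'⟩⟩
    · exact Or.inl h

/-- The identity of the whole tree. -/
protected def refl : Representative T where
  toPartialEquiv := PartialEquiv.refl T
  source_cofinite := isCofiniteSubspace_univ
  target_cofinite := isCofiniteSubspace_univ
  le_iff_le _ _ _ _ := Iff.rfl

/-- The inverse representative. -/
protected def symm (φ : Representative T) : Representative T where
  toPartialEquiv := φ.toPartialEquiv.symm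
  source_cofinite := φ.target_cofinite
  target_cofinite := φ.source_cofinite
  le_iff_le x hx y hy := by
    have h := φ.le_iff_le _ (φ.map_target hx) _ (φ.map_target hy)
    rw [φ.right_inv hx, φ.right_inv hy] at h
    exact h.symm

/-- The composition `x ↦ φ (ψ x)`, defined wherever this makes sense. -/
protected def comp (φ ψ : Representative T) : Representative T where
  toPartialEquiv := ψ.toPartialEquiv.trans φ.toPartialEquiv
  source_cofinite := ψ.cofinite_preimage φ.source_cofinite
  target_cofinite := φ.symm.cofinite_preimage ψ.target_cofinite
  le_iff_le _ hx _ hy :=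
    (φ.le_iff_le _ hx.2 _ hy.2).trans (ψ.le_iff_le _ hx.1 _ hy.1)

/-- Two representatives are equivalent if they agree on some cofinite subspace on which both are
defined. -/
def Equivalent (φ ψ : Representative T) : Prop :=
  ∃ S : Set T, IsCofiniteSubspace S ∧ S ⊆ φ.source ∧ S ⊆ ψ.source ∧ Set.EqOn φ ψ S

theorem Equivalent.symm_comp (φ : Representative T) :
    (φ.symm.comp φ).Equivalent Representative.refl :=
  ⟨φ.source, φ.source_cofinite, fun _ hx => ⟨hx, φ.map_source hx⟩, fun _ _ => trivial,
    fun _ hx => φ.left_inv hx⟩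

theorem Equivalent.comp {φ φ' ψ ψ' : Representative T} (h : φ.Equivalent φ')
    (h' : ψ.Equivalent ψ') : (φ.comp ψ).Equivalent (φ'.comp ψ') := by
  obtain ⟨S, hS, h1, h2, h3⟩ := h
  obtain ⟨S', hS', h1', h2', h3'⟩ := h'
  refine ⟨S' ∩ (ψ.source ∩ ψ ⁻¹' S), hS'.inter (ψ.cofinite_preimage hS),
    fun x hx => ⟨hx.2.1, h1 hx.2.2⟩, fun x hx => ⟨h2' hx.1, ?_⟩, fun x hx => ?_⟩
  · have := h2 hx.2.2
    rwa [h3' hx.1] at this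
  · have := h3 hx.2.2
    rw [h3' hx.1] at this
    change φ (ψ x) = φ' (ψ' x)
    rw [h3' hx.1, this]

theorem Equivalent.symm {φ ψ : Representative T} (h : φ.Equivalent ψ) : ψ.Equivalent φ :=
  let ⟨S, hS, h1, h2, h3⟩ := h
  ⟨S, hS, h2, h1, h3.symm⟩

theorem Equivalent.inv {φ ψ : Representative T} (h : φ.Equivalent ψ) :
    φ.symm.Equivalent ψ.symm := by
  obtain ⟨S, hS, h1, h2, h3⟩ := h
  refine ⟨φ.target ∩ φ.symm ⁻¹' S, φ.symm.cofinite_preimage hS, fun x hx => hx.1,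
    fun x hx => ?_, fun x hx => ?_⟩
  · have := ψ.map_source (h2 hx.2)
    rw [← h3 hx.2] at this
    change φ (φ.toPartialEquiv.symm x) ∈ ψ.target at this
    rwa [φ.right_inv hx.1] at this
  · have := ψ.left_inv (h2 hx.2)
    rw [← h3 hx.2] at this
    change ψ.toPartialEquiv.symm (φ (φ.toPartialEquiv.symm x)) = _ at this
    rw [φ.right_inv hx.1] at this
    exact this.symm

variable (T) in
/-- Equivalence of representatives. -/
instance setoid : Setoid (Representative T) where
  r := Equivalent
  iseqv :=
    { refl := fun φ => ⟨φ.source, φ.source_cofinite, subset_rfl, subset_rfl, fun _ _ => rfl⟩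
      symm := Equivalent.symm
      trans := by
        rintro φ ψ χ ⟨S, hS, h1, h2, h3⟩ ⟨S', hS', h1', h2', h3'⟩
        exact ⟨S ∩ S', hS.inter hS', fun x hx => h1 hx.1, fun x hx => h2' hx.2,
          fun x hx => (h3 hx.1).trans (h3' hx.2)⟩ }

end Representative

variable (T) in
/-- The group of almost automorphisms. -/
def AlmostAut : Type _ := Quotient (Representative.setoid T)

/-- The class of a representative. -/
def AlmostAut.mk (φ : Representative T) : AlmostAut T := Quotient.mk _ φ

instance : Mul (AlmostAut T) :=
  ⟨Quotient.map₂ Representative.comp fun _ _ h _ _ h' => h.comp h'⟩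

instance : One (AlmostAut T) := ⟨AlmostAut.mk Representative.refl⟩

instance : Inv (AlmostAut T) := ⟨Quotient.map Representative.symm fun _ _ h => h.inv⟩

instance : Group (AlmostAut T) :=
  Group.ofLeftAxioms
    (by
      rintro ⟨a⟩ ⟨b⟩ ⟨c⟩
      refine Quotient.sound ⟨((a.comp b).comp c).source, ((a.comp b).comp c).source_cofinite,
        subset_rfl, fun x hx => ⟨⟨hx.1, hx.2.1⟩, hx.2.2⟩, fun _ _ => rfl⟩)
    (by
      rintro ⟨a⟩
      exact Quotient.sound ⟨a.source, a.source_cofinite, fun x hx => ⟨hx, trivial⟩, subset_rfl,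
        fun _ _ => rfl⟩)
    (by
      rintro ⟨a⟩
      exact Quotient.sound (Representative.Equivalent.symm_comp a))

end Order

/-! ### Directed graphs and unfolding trees

A directed graph, possibly with loops and multiple edges, is a `Quiver`; its walks are the
`Quiver.Path`s. -/

section Graph

variable {V : Type u} [Quiver.{v} V]

/-- `R` is a root: every vertex is reached by a walk from `R`. -/
def IsRoot (R : V) : Prop := ∀ w : V, Quiver.Reachable R w

/-- A sink: a vertex without outgoing edges. -/
def IsSink (a : V) : Prop := ∀ w : V, IsEmpty (a ⟶ w)

/-- The vertices of the unfolding tree based on `R`: the walks that start at `R`. -/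
@[ext]
structure UnfoldingTree (R : V) where
  /-- the last vertex of the walk -/
  terminus : V
  /-- the walk -/
  walk : Quiver.Path R terminus

namespace UnfoldingTree

variable {R : V}

/-- The concatenation `pq` of a walk `p` from `R` with a walk `q` that starts where `p` ends. -/
def append (p : UnfoldingTree R) {w : V} (q : Quiver.Path p.terminus w) : UnfoldingTree R :=
  ⟨w, p.walk.comp q⟩

theorem append_nil (p : UnfoldingTree R) : p.append Quiver.Path.nil = p := rfl

theorem append_append (p : UnfoldingTree R) {w x : V} (q : Quiver.Path p.terminus w) (r : Quiver.Path w x) :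
    (p.append q).append r = p.append (q.comp r) := by
  simp [append]

/-- The prefix order. The edges `(p, pe)` of the unfolding tree are its covering relations. -/
instance : LE (UnfoldingTree R) :=
  ⟨fun p q => ∃ r : Quiver.Path p.terminus q.terminus, q.walk = p.walk.comp r⟩

theorem le_iff {p q : UnfoldingTree R} :
    p ≤ q ↔ ∃ (w : V) (r : Quiver.Path p.terminus w), q = p.append r := by
  constructor
  · rintro ⟨r, hr⟩
    refine ⟨q.terminus, r, ?_⟩
    cases q
    simp only at hr r ⊢
    simp [append, hr]
  · rintro ⟨w, r, rfl⟩
    exact ⟨r, rfl⟩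

theorem le_append (p : UnfoldingTree R) {w : V} (r : Quiver.Path p.terminus w) : p ≤ p.append r :=
  ⟨r, rfl⟩

theorem length_le {p q : UnfoldingTree R} (h : p ≤ q) : p.walk.length ≤ q.walk.length := by
  obtain ⟨r, hr⟩ := h
  rw [hr, Quiver.Path.length_comp]
  omega

theorem eq_of_le_of_length {p q : UnfoldingTree R} (h : p ≤ q)
    (hl : q.walk.length ≤ p.walk.length) : p = q := by
  obtain ⟨w, r, rfl⟩ := le_iff.1 h
  have h0 : r.length = 0 := by
    simp only [append, Quiver.Path.length_comp] at hl
    omega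
  obtain rfl := Quiver.Path.eq_of_length_zero r h0
  rw [Quiver.Path.eq_nil_of_length_zero r h0, append_nil]

instance : PartialOrder (UnfoldingTree R) where
  le_refl p := ⟨Quiver.Path.nil, rfl⟩
  le_trans p q r := by
    rintro ⟨x, hx⟩ ⟨y, hy⟩
    exact ⟨x.comp y, by rw [hy, hx, Quiver.Path.comp_assoc]⟩
  le_antisymm _ _ h h' := eq_of_le_of_length h (length_le h')

/-- Every element of a set of walks lies above a minimal one. -/
theorem exists_basis_le {S : Set (UnfoldingTree R)} {p : UnfoldingTree R} (hp : p ∈ S) :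
    ∃ b ∈ basis S, b ≤ p := by
  have wf : WellFounded fun x y : UnfoldingTree R => x.walk.length < y.walk.length :=
    (measure fun x : UnfoldingTree R => x.walk.length).wf
  obtain ⟨b, ⟨hbS, hbp⟩, hb⟩ := wf.has_min {x | x ∈ S ∧ x ≤ p} ⟨p, hp, le_refl p⟩
  refine ⟨b, ⟨hbS, fun y hy hyb => ?_⟩, hbp⟩
  have h := hb y ⟨hy, hyb.trans hbp⟩
  exact (eq_of_le_of_length hyb (not_lt.1 h)).ge

end UnfoldingTree

/-- A representative `φ` is a Higman-Thompson representative if `φ (bp) = φ (b) p` for all `b` in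
the basis of its domain and all walks `p` from the terminus of `b`. For the right-hand side to make
sense, `φ (b)` has to end where `b` ends. -/
def IsHTRepresentative {R : V} (φ : Representative (UnfoldingTree R)) : Prop :=
  ∀ b ∈ basis φ.source, ∃ h : b.terminus = (φ b).terminus,
    ∀ (w : V) (p : Quiver.Path b.terminus w), φ (b.append p) = (φ b).append (p.cast h rfl)

theorem IsHTRepresentative.apply_append {R : V} {φ : Representative (UnfoldingTree R)}
    (hφ : IsHTRepresentative φ) {s : UnfoldingTree R} (hs : s ∈ φ.source) :
    ∃ h : s.terminus = (φ s).terminus,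
      ∀ (w : V) (p : Quiver.Path s.terminus w), φ (s.append p) = (φ s).append (p.cast h rfl) := by
  obtain ⟨b, hb, hbs⟩ := UnfoldingTree.exists_basis_le hs
  obtain ⟨x, r, rfl⟩ := UnfoldingTree.le_iff.1 hbs
  obtain ⟨h, H⟩ := hφ b hb
  have key : φ (b.append r) = (φ b).append (r.cast h rfl) := H x r
  have h' : x = (φ (b.append r)).terminus := by rw [key]; rfl
  refine ⟨h', fun w p => ?_⟩
  refine (congrArg φ (b.append_append r p)).trans ((H w (r.comp p)).trans ?_)
  generalize φ (b.append r) = d at key h' ⊢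
  subst key
  generalize φ b = c at h h' ⊢
  obtain ⟨cv, cw⟩ := c
  simp only at h
  subst h
  simp only [UnfoldingTree.append, Quiver.Path.cast_rfl_rfl, Quiver.Path.comp_assoc]
  rfl

/-- The Higman-Thompson group of the unfolding tree based on `R`: the almost automorphisms that
have a Higman-Thompson representative. -/
def HT (R : V) : Subgroup (AlmostAut (UnfoldingTree R)) where
  carrier := {g | ∃ φ : Representative (UnfoldingTree R), IsHTRepresentative φ ∧
    AlmostAut.mk φ = g}
  one_mem' := ⟨Representative.refl, fun _ _ => ⟨rfl, fun _ _ => rfl⟩, rfl⟩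
  mul_mem' := by
    rintro _ _ ⟨φ, hφ, rfl⟩ ⟨ψ, hψ, rfl⟩
    refine ⟨φ.comp ψ, fun b hb => ?_, rfl⟩
    obtain ⟨h1, H1⟩ := hψ.apply_append hb.1.1
    obtain ⟨h2, H2⟩ := hφ.apply_append (s := ψ b) hb.1.2
    refine ⟨h1.trans h2, fun w p => ?_⟩
    change φ (ψ (b.append p)) = (φ (ψ b)).append _
    rw [H1, H2, Quiver.Path.cast_cast]
    rfl
  inv_mem' := by
    rintro _ ⟨φ, hφ, rfl⟩
    refine ⟨φ.symm, fun b hb => ?_, rfl⟩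
    have hb' : b ∈ φ.target := hb.1
    obtain ⟨s, hs, rfl⟩ : ∃ s ∈ φ.source, φ s = b :=
      ⟨_, φ.map_target hb', φ.right_inv hb'⟩
    obtain ⟨h, H⟩ := hφ.apply_append hs
    have e : φ.symm (φ s) = s := φ.left_inv hs
    refine ⟨by rw [e, h], fun w p => ?_⟩
    generalize_proofs pf
    revert pf
    rw [e]
    intro pf
    have hu : s.append (p.cast pf rfl) ∈ φ.source :=
      φ.source_cofinite.isUpperSet (s.le_append _) hs
    have h3 := H w (p.cast pf rfl)
    rw [Quiver.Path.cast_cast, Quiver.Path.cast_rfl_rfl] at h3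
    rw [← h3]
    exact φ.left_inv hu

/-- The vertices of the reduced graph `G_M`: the elements of `M`. -/
def Reduced (M : Set V) : Type u := M

/-- The edges of the reduced graph `G_M` from `a` to `b`: the nonempty walks from `a` to `b` of
which no proper nonempty prefix ends in `M`. -/
instance (M : Set V) : Quiver (Reduced M) where
  Hom a b := {p : Quiver.Path a.1 b.1 // 0 < p.length ∧
    ∀ (c : V) (q : Quiver.Path a.1 c) (r : Quiver.Path c b.1),
      p = q.comp r → 0 < q.length → 0 < r.length → c ∉ M}

end Graph

end HigmanThompson

namespace HigmanThompson

/-! Cutting a walk of `G` between vertices of `M` at each of its visits to `M` factors it uniquely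
into edges of `G_M` (`exists_expand_eq`, `expand_injective`). Hence `embed` identifies the tree of
`G_M` with the walks of `G` from `R` that end in `M`, with the induced order; surjectivity of the
factorization also shows that `R` is a root of `G_M`.

A Higman-Thompson representative for `G` preserves last vertices, so it restricts to the walks
ending in `M` (`exists_corresponds_right`). Conversely, one for `G_M` extends to every walk with a
prefix in its domain by carrying the remaining tail along (`exists_corresponds_left`). The extended
domain is cofinite: after its last visit to `M` a walk cannot close a cycle, so it repeats no vertex
and only finitely many tails are possible (`Avoids.nodup_vertices`,
`IsCofiniteSubspace.upperEmbed`).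

Both passages are recorded by the relation `Corresponds`, which is compatible with composition and,
for Higman-Thompson representatives, with equivalence in both directions. On classes it is therefore
the graph of an isomorphism. -/

/-! ### Isomorphisms from correspondences -/

/-- A multiplicative one-to-one correspondence between two groups gives an isomorphism. -/
theorem nonempty_mulEquiv_of_correspondence {A B : Type*} [Group A] [Group B] (r : A → B → Prop)
    (total : ∀ a, ∃ b, r a b) (surj : ∀ b, ∃ a, r a b)
    (unique : ∀ a b b', r a b → r a b' → b = b') (inj : ∀ a a' b, r a b → r a' b → a = a')
    (mul : ∀ a a' b b', r a b → r a' b' → r (a * a') (b * b')) : Nonempty (A ≃* B) := by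
  choose f hf using total
  let F : A →* B := MonoidHom.mk' f fun a a' => unique _ _ _ (hf _) (mul _ _ _ _ (hf a) (hf a'))
  refine ⟨MulEquiv.ofBijective F ⟨fun a a' h => ?_, fun b => ?_⟩⟩
  · have h' : f a = f a' := h
    exact inj a a' (f a) (hf a) (h' ▸ hf a')
  · obtain ⟨a, ha⟩ := surj b
    exact ⟨a, unique _ _ _ (hf a) ha⟩

/-! ### Constructing representatives -/

section Order

variable {T : Type*} [PartialOrder T]

/-- A representative from mutually inverse monotone maps between cofinite subspaces. -/
def Representative.ofMonotone (f g : T → T) {S S' : Set T} (hS : IsCofiniteSubspace S)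
    (hS' : IsCofiniteSubspace S') (hf : ∀ x ∈ S, f x ∈ S') (hg : ∀ x ∈ S', g x ∈ S)
    (hgf : ∀ x ∈ S, g (f x) = x) (hfg : ∀ x ∈ S', f (g x) = x)
    (mf : ∀ x ∈ S, ∀ y, x ≤ y → f x ≤ f y) (mg : ∀ x ∈ S', ∀ y, x ≤ y → g x ≤ g y) :
    Representative T where
  toFun := f
  invFun := g
  source := S
  target := S'
  map_source' := hf
  map_target' := hg
  left_inv' := hgf
  right_inv' := hfg
  source_cofinite := hS
  target_cofinite := hS'
  le_iff_le x hx y hy := by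
    refine ⟨fun h => ?_, mf x hx y⟩
    have := mg _ (hf x hx) _ h
    rwa [hgf x hx, hgf y hy] at this

end Order

/-! ### Parallel extensions -/

section Graph

variable {V : Type u} [Quiver.{v} V]

/-- Two walks that start at the same vertex and are prefixes of the same walk are comparable. -/
theorem exists_comp_of_comp_eq_comp {a b c d : V} (p : Quiver.Path a b) (q : Quiver.Path b d)
    (p' : Quiver.Path a c) (q' : Quiver.Path c d) (h : p.comp q = p'.comp q') :
    (∃ r : Quiver.Path b c, p' = p.comp r ∧ q = r.comp q') ∨
      ∃ r : Quiver.Path c b, p = p'.comp r ∧ q' = r.comp q := by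
  induction q with
  | nil => exact Or.inr ⟨q', by simpa using h, by simp⟩
  | cons q e ih =>
    cases q' with
    | nil => exact Or.inl ⟨q.cons e, by simpa using h.symm, by simp⟩
    | cons q' e' =>
      rw [Quiver.Path.comp_cons, Quiver.Path.comp_cons] at h
      obtain rfl := Quiver.Path.obj_eq_of_cons_eq_cons h
      obtain rfl := eq_of_heq (Quiver.Path.hom_heq_of_cons_eq_cons h)
      rcases ih q' (eq_of_heq (Quiver.Path.heq_of_cons_eq_cons h)) with ⟨r, h1, h2⟩ | ⟨r, h1, h2⟩
      · exact Or.inl ⟨r, h1, by rw [h2, Quiver.Path.comp_cons]⟩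
      · exact Or.inr ⟨r, h1, by rw [h2, Quiver.Path.comp_cons]⟩

/-- Serves to show that the extension of a representative to `G` does not depend on the prefix used
to compute it. -/
theorem UnfoldingTree.le_total_of_le {R : V} {x y z : UnfoldingTree R} (hx : x ≤ z) (hy : y ≤ z) :
    x ≤ y ∨ y ≤ x := by
  obtain ⟨r, hr⟩ := hx
  obtain ⟨r', hr'⟩ := hy
  rcases exists_comp_of_comp_eq_comp _ _ _ _ (hr.symm.trans hr') with ⟨t, h, -⟩ | ⟨t, h, -⟩
  · exact Or.inl ⟨t, h⟩
  · exact Or.inr ⟨t, h⟩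

/-- The walks `s'` and `t'` extend `s` and `t` by the same walk. -/
def ParallelExtension {R : V} (s t s' t' : UnfoldingTree R) : Prop :=
  ∃ (v w : V) (a b : Quiver.Path R v) (p : Quiver.Path v w),
    s = ⟨v, a⟩ ∧ t = ⟨v, b⟩ ∧ s' = ⟨w, a.comp p⟩ ∧ t' = ⟨w, b.comp p⟩

namespace ParallelExtension

variable {R : V} {s t s' t' s'' t'' u : UnfoldingTree R}

theorem symm (h : ParallelExtension s t s' t') : ParallelExtension t s t' s' := by
  obtain ⟨v, w, a, b, p, h1, h2, h3, h4⟩ := h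
  exact ⟨v, w, b, a, p, h2, h1, h4, h3⟩

theorem terminus_eq (h : ParallelExtension s t s' t') : s.terminus = t.terminus := by
  obtain ⟨v, w, a, b, p, rfl, rfl, rfl, rfl⟩ := h
  rfl

theorem terminus_eq' (h : ParallelExtension s t s' t') : s'.terminus = t'.terminus := by
  obtain ⟨v, w, a, b, p, rfl, rfl, rfl, rfl⟩ := h
  rfl

theorem le (h : ParallelExtension s t s' t') : s ≤ s' := by
  obtain ⟨v, w, a, b, p, rfl, rfl, rfl, rfl⟩ := h
  exact ⟨p, rfl⟩

/-- Left cancellation: `s` and `s'` determine the common tail. -/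
theorem unique (h : ParallelExtension s t s' t') (h' : ParallelExtension s t s' u) : t' = u := by
  obtain ⟨v, w, a, b, p, rfl, rfl, rfl, rfl⟩ := h
  obtain ⟨v', w', a', b', p', h1, h2, h3, rfl⟩ := h'
  cases h1
  cases h2
  rw [UnfoldingTree.mk.injEq] at h3
  obtain ⟨rfl, h3⟩ := h3
  rw [(Quiver.Path.comp_injective_right a) (eq_of_heq h3)]

theorem trans (h : ParallelExtension s t s' t') (h' : ParallelExtension s' t' s'' t'') :
    ParallelExtension s t s'' t'' := by
  obtain ⟨v, w, a, b, p, rfl, rfl, rfl, rfl⟩ := h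
  obtain ⟨v', w', a', b', p', h1, h2, rfl, rfl⟩ := h'
  cases h1
  cases h2
  exact ⟨v, w', a, b, p.comp p', rfl, rfl, by rw [Quiver.Path.comp_assoc],
    by rw [Quiver.Path.comp_assoc]⟩

theorem exists_of_le (h : s.terminus = t.terminus) (hs : s ≤ s') :
    ∃ t', ParallelExtension s t s' t' := by
  obtain ⟨w, r, rfl⟩ := UnfoldingTree.le_iff.1 hs
  obtain ⟨v, a⟩ := s
  obtain ⟨v', b⟩ := t
  obtain rfl : v = v' := h
  exact ⟨⟨w, b.comp r⟩, v, w, a, b, r, rfl, rfl, rfl, rfl⟩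

/-- Both tails are what follows `t` in `t'`, so they coincide by left cancellation. -/
theorem comp (h : ParallelExtension s t s' t') (h' : ParallelExtension t u t' t'') :
    ParallelExtension s u s' t'' := by
  obtain ⟨v, w, a, b, p, rfl, rfl, rfl, rfl⟩ := h
  obtain ⟨v', w', a', b', p', h1, rfl, h3, rfl⟩ := h'
  cases h1
  rw [UnfoldingTree.mk.injEq] at h3
  obtain ⟨rfl, h3⟩ := h3
  obtain rfl := (Quiver.Path.comp_injective_right b) (eq_of_heq h3)
  exact ⟨v, w, a, b', p, rfl, rfl, rfl, rfl⟩

/-- Extensions of parallel extensions are parallel. -/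
theorem of_le (h : ParallelExtension s t s' t') (h' : ParallelExtension s t s'' t'')
    (hle : s' ≤ s'') : ParallelExtension s' t' s'' t'' := by
  obtain ⟨u, hu⟩ := exists_of_le h.terminus_eq' hle
  rwa [h'.unique (h.trans hu)]

end ParallelExtension

/-- Replaces the basis by the whole domain and removes the casts between last vertices; the
arguments below use this form. -/
theorem isHTRepresentative_iff {R : V} {φ : Representative (UnfoldingTree R)} :
    IsHTRepresentative φ ↔ ∀ s ∈ φ.source, ∀ s', s ≤ s' → ParallelExtension s (φ s) s' (φ s') := by
  constructor
  · intro hφ s hs s' hle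
    obtain ⟨h, H⟩ := hφ.apply_append hs
    obtain ⟨w, r, rfl⟩ := UnfoldingTree.le_iff.1 hle
    rw [H]
    generalize φ s = t at h
    obtain ⟨v, a⟩ := s
    obtain ⟨v', b⟩ := t
    obtain rfl : v = v' := h
    exact ⟨v, w, a, b, r, rfl, rfl, rfl, rfl⟩
  · intro H b hb
    have h := (H b hb.1 b le_rfl).terminus_eq
    refine ⟨h, fun w p => ?_⟩
    refine (H b hb.1 _ (b.le_append p)).unique ?_
    generalize φ b = t at h
    obtain ⟨v, a⟩ := b
    obtain ⟨v', b⟩ := t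
    obtain rfl : v = v' := h
    exact ⟨v, w, a, b, p, rfl, rfl, rfl, rfl⟩

theorem IsHTRepresentative.symm {R : V} {φ : Representative (UnfoldingTree R)}
    (hφ : IsHTRepresentative φ) : IsHTRepresentative φ.symm := by
  rw [isHTRepresentative_iff] at hφ ⊢
  intro s hs s' hle
  have hs' : s' ∈ φ.target := φ.target_cofinite.isUpperSet hle hs
  have h := (hφ _ (φ.map_target hs) (φ.symm s')
    ((φ.symm.le_iff_le s hs s' hs').2 hle)).symm
  have e : φ (φ.toPartialEquiv.symm s) = s := φ.right_inv hs
  have e' : φ (φ.symm s') = s' := φ.right_inv hs'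
  rwa [e', e] at h

theorem IsHTRepresentative.comp {R : V} {φ ψ : Representative (UnfoldingTree R)}
    (hφ : IsHTRepresentative φ) (hψ : IsHTRepresentative ψ) : IsHTRepresentative (φ.comp ψ) := by
  rw [isHTRepresentative_iff] at hφ hψ ⊢
  intro s hs s' hle
  have h := hψ s hs.1 s' hle
  exact h.comp (hφ (ψ s) hs.2 (ψ s') h.symm.le)

/-! ### Finiteness of sets of walks -/

theorem finite_setOf_length_le [Finite V] [∀ a b : V, Finite (a ⟶ b)] (a : V) (n : ℕ) :
    {z : UnfoldingTree a | z.walk.length ≤ n}.Finite := by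
  induction n with
  | zero =>
    refine (Set.finite_singleton (⟨a, Quiver.Path.nil⟩ : UnfoldingTree a)).subset ?_
    rintro ⟨v, p⟩ hp
    cases p with
    | nil => rfl
    | cons p e => simp at hp
  | succ n ih =>
    have : Finite {z : UnfoldingTree a | z.walk.length ≤ n} := ih
    let F : (Σ (z : {z : UnfoldingTree a | z.walk.length ≤ n}) (v : V), z.1.terminus ⟶ v) →
      UnfoldingTree a := fun x => ⟨x.2.1, x.1.1.walk.cons x.2.2⟩
    refine ((Set.finite_singleton (⟨a, Quiver.Path.nil⟩ : UnfoldingTree a)).union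
      (Set.finite_range F)).subset ?_
    rintro ⟨v, p⟩ hp
    cases p with
    | nil => exact Or.inl rfl
    | cons p e =>
      refine Or.inr ⟨⟨⟨⟨_, p⟩, ?_⟩, _, e⟩, rfl⟩
      simpa using hp

/-- No nonempty prefix of the walk `z` ends in `M`. -/
def Avoids (M : Set V) {a b : V} (z : Quiver.Path a b) : Prop :=
  ∀ (c : V) (q : Quiver.Path a c) (r : Quiver.Path c b), z = q.comp r → 0 < q.length → c ∉ M

theorem Avoids.of_comp {M : Set V} {a b c : V} {p : Quiver.Path a b} {q : Quiver.Path b c}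
    (h : Avoids M (p.comp q)) : Avoids M p := by
  rintro d p₁ p₂ rfl
  exact h d p₁ (p₂.comp q) (by rw [Quiver.Path.comp_assoc])

/-- A repeated vertex closes a nonempty cycle, which must visit `M`; the walk up to that visit is a
prefix that avoidance forbids. -/
theorem Avoids.nodup_vertices {M : Set V}
    (hM : ∀ (a : V) (c : Quiver.Path a a), 0 < c.length → ∃ w ∈ M, w ∈ c.vertices)
    {a b : V} (z : Quiver.Path a b) (h : Avoids M z) : z.vertices.Nodup := by
  induction z with
  | nil => simp
  | @cons v b z e ih =>
    have hz : Avoids M z := Avoids.of_comp (q := e.toPath) h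
    rw [Quiver.Path.vertices_cons, List.concat_eq_append, List.nodup_append_comm,
      List.singleton_append, List.nodup_cons]
    refine ⟨fun hb => ?_, ih hz⟩
    obtain ⟨p, q, rfl⟩ := z.exists_eq_comp_of_mem_vertices hb
    obtain ⟨w, hw, hwc⟩ := hM b (q.cons e) (by simp)
    obtain ⟨c₁, c₂, hc⟩ := (q.cons e).exists_eq_comp_of_mem_vertices hwc
    have hcl : 0 < c₁.length + c₂.length := by
      rw [← Quiver.Path.length_comp, ← hc]; simp
    -- Avoidance only tolerates the empty prefix at `w`. Then `w` is the vertex `b` that closes the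
    -- cycle, and the whole walk is a nonempty prefix ending in `M`.
    have hpc : (p.comp c₁).length = 0 := by
      by_contra hpos
      exact h w (p.comp c₁) c₂ (by rw [Quiver.Path.comp_assoc, ← hc, Quiver.Path.comp_cons])
        (Nat.pos_of_ne_zero hpos) hw
    have hc₁ : c₁.length = 0 := by
      rw [Quiver.Path.length_comp] at hpc; omega
    obtain rfl := Quiver.Path.eq_of_length_zero c₁ hc₁
    exact h b ((p.comp q).cons e) Quiver.Path.nil rfl (by simp) hw

theorem Avoids.length_lt [Finite V] {M : Set V}
    (hM : ∀ (a : V) (c : Quiver.Path a a), 0 < c.length → ∃ w ∈ M, w ∈ c.vertices)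
    {a b : V} {z : Quiver.Path a b} (h : Avoids M z) : z.length < Nat.card V := by
  have := Fintype.ofFinite V
  have hl := (h.nodup_vertices hM z).length_le_card
  rw [Quiver.Path.vertices_length] at hl
  rw [Nat.card_eq_fintype_card]
  omega

/-! ### Expanding walks of the reduced graph -/

variable {M : Set V}

/-- The walk of `G` that a walk of `G_M` stands for. -/
def expand {a : Reduced M} : ∀ {b : Reduced M}, Quiver.Path a b → Quiver.Path a.1 b.1
  | _, .nil => .nil
  | _, .cons p e => (expand p).comp e.1

theorem expand_comp {a b c : Reduced M} (p : Quiver.Path a b) (q : Quiver.Path b c) :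
    expand (p.comp q) = (expand p).comp (expand q) := by
  induction q with
  | nil => rfl
  | cons q e ih => simp only [Quiver.Path.comp_cons, expand, ih, Quiver.Path.comp_assoc]

/-- The cut is made at the last visit to `M`. Appending an edge either prolongs the rest `z` or, if
it arrives in `M`, turns the rest into a new edge of `G_M`. -/
theorem exists_expand_comp_avoids (a : Reduced M) {b : V} (p : Quiver.Path a.1 b) :
    ∃ (c : Reduced M) (q : Quiver.Path a c) (z : Quiver.Path c.1 b),
      p = (expand q).comp z ∧ Avoids M z := by
  induction p with
  | nil =>
    refine ⟨a, .nil, .nil, rfl, fun c q r h hq => ?_⟩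
    have := congrArg Quiver.Path.length h
    simp only [Quiver.Path.length_nil, Quiver.Path.length_comp] at this
    omega
  | @cons v b p e ih =>
    obtain ⟨c, q, z, rfl, hz⟩ := ih
    -- A proper prefix of `z.cons e` is already a prefix of `z`.
    have key : ∀ (d : V) (q' : Quiver.Path c.1 d) (r : Quiver.Path d b),
        z.cons e = q'.comp r → 0 < q'.length → 0 < r.length → d ∉ M := by
      intro d q' r h hq hr
      cases r with
      | nil => simp at hr
      | cons r e' =>
        rw [Quiver.Path.comp_cons] at h
        obtain rfl := Quiver.Path.obj_eq_of_cons_eq_cons h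
        exact hz d q' r (eq_of_heq (Quiver.Path.heq_of_cons_eq_cons h)) hq
    by_cases hb : b ∈ M
    · exact ⟨⟨b, hb⟩, q.cons ⟨z.cons e, by simp, key⟩, .nil, rfl, fun c q r h hq => by
        have := congrArg Quiver.Path.length h
        simp only [Quiver.Path.length_nil, Quiver.Path.length_comp] at this
        omega⟩
    · refine ⟨c, q, z.cons e, rfl, fun d q' r h hq => ?_⟩
      rcases Nat.eq_zero_or_pos r.length with h0 | h0
      · rwa [Quiver.Path.eq_of_length_zero r h0]
      · exact key d q' r h hq h0

/-- When the end lies in `M`, the rest after the last visit to `M` is empty. -/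
theorem exists_expand_eq {a b : Reduced M} (p : Quiver.Path a.1 b.1) :
    ∃ q : Quiver.Path a b, expand q = p := by
  obtain ⟨c, q, z, rfl, hz⟩ := exists_expand_comp_avoids a p
  have h0 : z.length = 0 := by
    by_contra h
    exact hz b.1 z .nil rfl (Nat.pos_of_ne_zero h) b.2
  obtain rfl : c = b := Subtype.ext (Quiver.Path.eq_of_length_zero z h0)
  exact ⟨q, by rw [Quiver.Path.eq_nil_of_length_zero z h0, Quiver.Path.comp_nil]⟩

/-- An edge of the reduced graph that is a suffix of another one is equal to it. -/
theorem Reduced.edge_suffix {a b c : Reduced M} (e : a ⟶ c) (e' : b ⟶ c) (r : Quiver.Path b.1 a.1)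
    (h : e'.1 = r.comp e.1) : a = b ∧ r.length = 0 := by
  have h0 : r.length = 0 := by
    by_contra hr
    exact e'.2.2 a.1 r e.1 h (Nat.pos_of_ne_zero hr) e.2.1 a.2
  exact ⟨Subtype.ext (Quiver.Path.eq_of_length_zero r h0).symm, h0⟩

/-- The last edges are suffixes of the same walk, so one is a suffix of the other and
`Reduced.edge_suffix` makes them equal; the remainders agree by induction. -/
theorem expand_injective {a b : Reduced M} (p q : Quiver.Path a b) (h : expand p = expand q) :
    p = q := by
  induction p with
  | nil =>
    cases q with
    | nil => rfl
    | cons q e =>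
      have h1 := congrArg Quiver.Path.length h
      have h2 := e.2.1
      simp only [expand, Quiver.Path.length_nil, Quiver.Path.length_comp] at h1
      omega
  | @cons b c p e ih =>
    cases q with
    | nil =>
      have h1 := congrArg Quiver.Path.length h
      have h2 := e.2.1
      simp only [expand, Quiver.Path.length_nil, Quiver.Path.length_comp] at h1
      omega
    | @cons b' _ q e' =>
      have hb : b = b' := by
        rcases exists_comp_of_comp_eq_comp _ _ _ _ h with ⟨r, -, h2⟩ | ⟨r, -, h2⟩
        · exact (Reduced.edge_suffix e' e r h2).1.symm
        · exact (Reduced.edge_suffix e e' r h2).1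
      subst hb
      -- The comparison is repeated because only now is `r` a closed walk, which can be replaced by
      -- `nil`.
      rcases exists_comp_of_comp_eq_comp _ _ _ _ h with ⟨r, h1, h2⟩ | ⟨r, h1, h2⟩
      · obtain rfl := Quiver.Path.eq_nil_of_length_zero r (Reduced.edge_suffix e' e r h2).2
        rw [Quiver.Path.nil_comp] at h2
        rw [ih q (by simpa using h1.symm), Subtype.ext h2]
      · obtain rfl := Quiver.Path.eq_nil_of_length_zero r (Reduced.edge_suffix e e' r h2).2
        rw [Quiver.Path.nil_comp] at h2
        rw [ih q (by simpa using h1), Subtype.ext h2]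

theorem isRoot_reduced {R : Reduced M} (hR : IsRoot R.1) : IsRoot R := fun w =>
  let ⟨p⟩ := hR w.1
  let ⟨q, _⟩ := exists_expand_eq p
  ⟨q⟩

/-! ### The embedding of unfolding trees -/

variable {R : Reduced M}

/-- The embedding of the unfolding tree of `G_M` into that of `G`. -/
def embed (y : UnfoldingTree R) : UnfoldingTree R.1 := ⟨y.terminus.1, expand y.walk⟩

theorem embed_injective : Function.Injective (embed (R := R)) := by
  rintro ⟨v, p⟩ ⟨w, q⟩ h
  simp only [embed, UnfoldingTree.mk.injEq] at h
  obtain rfl : v = w := Subtype.ext h.1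
  rw [expand_injective p q (eq_of_heq h.2)]

/-- The tail between the two embedded walks starts and ends in `M`, so it is itself an expansion. -/
theorem embed_le_embed {x y : UnfoldingTree R} : embed x ≤ embed y ↔ x ≤ y := by
  constructor
  · rintro ⟨r, hr⟩
    obtain ⟨q, rfl⟩ := exists_expand_eq (a := x.terminus) (b := y.terminus) r
    exact ⟨q, expand_injective _ _ (hr.trans (expand_comp _ _).symm)⟩
  · rintro ⟨r, hr⟩
    exact ⟨expand r, by simp only [embed]; rw [hr, expand_comp]⟩

theorem exists_embed_eq {x : UnfoldingTree R.1} (h : x.terminus ∈ M) :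
    ∃ y : UnfoldingTree R, embed y = x := by
  obtain ⟨v, p⟩ := x
  let w : Reduced M := ⟨v, h⟩
  obtain ⟨q, hq⟩ := exists_expand_eq (a := R) (b := w) p
  exact ⟨⟨w, q⟩, UnfoldingTree.ext rfl (heq_of_eq hq)⟩

theorem ParallelExtension.embed {s t s' t' : UnfoldingTree R} (h : ParallelExtension s t s' t') :
    ParallelExtension (embed s) (embed t) (embed s') (embed t') := by
  obtain ⟨v, w, a, b, p, rfl, rfl, rfl, rfl⟩ := h
  exact ⟨v.1, w.1, expand a, expand b, expand p, rfl, rfl,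
    by simp only [HigmanThompson.embed, expand_comp],
    by simp only [HigmanThompson.embed, expand_comp]⟩

theorem ParallelExtension.of_embed {s t s' t' : UnfoldingTree R}
    (h : ParallelExtension (HigmanThompson.embed s) (HigmanThompson.embed t)
      (HigmanThompson.embed s') (HigmanThompson.embed t')) : ParallelExtension s t s' t' := by
  obtain ⟨u, hu⟩ := exists_of_le (s := s) (t := t) (Subtype.ext h.terminus_eq)
    (embed_le_embed.1 h.le)
  rwa [embed_injective (h.unique hu.embed)]

theorem IsCofiniteSubspace.preimage_embed {S : Set (UnfoldingTree R.1)}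
    (hS : IsCofiniteSubspace S) : IsCofiniteSubspace (embed (R := R) ⁻¹' S) :=
  ⟨fun _ _ hxy hx => hS.isUpperSet (embed_le_embed.2 hxy) hx,
    hS.finite_compl.preimage embed_injective.injOn⟩

/-- The walks in `G` that have a prefix in the image of `S`. -/
def upperEmbed (S : Set (UnfoldingTree R)) : Set (UnfoldingTree R.1) :=
  {x | ∃ s ∈ S, embed s ≤ x}

/-- A walk outside is a walk of `G_M` outside `S` followed by a rest that avoids `M`. There are
finitely many of the former, and the latter is shorter than the number of vertices. -/
theorem IsCofiniteSubspace.upperEmbed [Finite V] [∀ a b : V, Finite (a ⟶ b)]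
    (hM : ∀ (a : V) (c : Quiver.Path a a), 0 < c.length → ∃ w ∈ M, w ∈ c.vertices)
    {S : Set (UnfoldingTree R)} (hS : IsCofiniteSubspace S) :
    IsCofiniteSubspace (upperEmbed S) := by
  refine ⟨fun x y hxy ⟨s, hs, hx⟩ => ⟨s, hs, hx.trans hxy⟩, ?_⟩
  refine (hS.finite_compl.biUnion fun y _ => (finite_setOf_length_le y.terminus.1
    (Nat.card V)).image fun z => (embed y).append z.walk).subset ?_
  rintro ⟨v, p⟩ hx
  obtain ⟨c, q, z, rfl, hz⟩ := exists_expand_comp_avoids R p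
  refine Set.mem_biUnion (x := (⟨c, q⟩ : UnfoldingTree R)) (fun hs => hx ⟨_, hs, z, rfl⟩) ?_
  exact ⟨⟨v, z⟩, (hz.length_lt hM).le, rfl⟩

/-! ### Corresponding representatives -/

/-- The representatives `φ` and `ψ` agree, up to the embedding, on a cofinite subspace. -/
def Corresponds (φ : Representative (UnfoldingTree R.1)) (ψ : Representative (UnfoldingTree R)) :
    Prop :=
  ∃ S : Set (UnfoldingTree R), IsCofiniteSubspace S ∧ S ⊆ ψ.source ∧ S ⊆ embed ⁻¹' φ.source ∧
    ∀ y ∈ S, φ (embed y) = embed (ψ y)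

namespace Corresponds

variable {φ φ' : Representative (UnfoldingTree R.1)} {ψ ψ' : Representative (UnfoldingTree R)}

theorem comp (h : Corresponds φ ψ) (h' : Corresponds φ' ψ') :
    Corresponds (φ.comp φ') (ψ.comp ψ') := by
  obtain ⟨S, hS, h1, h2, h3⟩ := h
  obtain ⟨S', hS', h1', h2', h3'⟩ := h'
  refine ⟨S' ∩ (ψ'.source ∩ ψ' ⁻¹' S), hS'.inter (ψ'.cofinite_preimage hS),
    fun x hx => ⟨hx.2.1, h1 hx.2.2⟩, fun x hx => ⟨h2' hx.1, ?_⟩, fun x hx => ?_⟩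
  · change φ' (embed x) ∈ φ.source
    rw [h3' x hx.1]
    exact h2 hx.2.2
  · change φ (φ' (embed x)) = embed (ψ (ψ' x))
    rw [h3' x hx.1, h3 _ hx.2.2]

theorem equivalent_right (h : Corresponds φ ψ) (h' : Corresponds φ' ψ') (e : φ.Equivalent φ') :
    ψ.Equivalent ψ' := by
  obtain ⟨S, hS, h1, h2, h3⟩ := h
  obtain ⟨S', hS', h1', h2', h3'⟩ := h'
  obtain ⟨U, hU, e1, e2, e3⟩ := e
  refine ⟨S ∩ S' ∩ embed ⁻¹' U, (hS.inter hS').inter hU.preimage_embed,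
    fun x hx => h1 hx.1.1, fun x hx => h1' hx.1.2, fun x hx => embed_injective ?_⟩
  rw [← h3 x hx.1.1, ← h3' x hx.1.2]
  exact e3 hx.2

/-- Agreement on walks ending in `M` says nothing by itself about other walks; the Higman-Thompson
property carries it over to all their extensions. -/
theorem equivalent_left [Finite V] [∀ a b : V, Finite (a ⟶ b)]
    (hM : ∀ (a : V) (c : Quiver.Path a a), 0 < c.length → ∃ w ∈ M, w ∈ c.vertices)
    (hφ : IsHTRepresentative φ) (hφ' : IsHTRepresentative φ')
    (h : Corresponds φ ψ) (h' : Corresponds φ' ψ') (e : ψ.Equivalent ψ') :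
    φ.Equivalent φ' := by
  rw [isHTRepresentative_iff] at hφ hφ'
  obtain ⟨S, hS, h1, h2, h3⟩ := h
  obtain ⟨S', hS', h1', h2', h3'⟩ := h'
  obtain ⟨U, hU, e1, e2, e3⟩ := e
  refine ⟨upperEmbed (S ∩ S' ∩ U), ((hS.inter hS').inter hU).upperEmbed hM, ?_, ?_, ?_⟩
  · rintro x ⟨s, hs, hx⟩
    exact φ.source_cofinite.isUpperSet hx (h2 hs.1.1)
  · rintro x ⟨s, hs, hx⟩
    exact φ'.source_cofinite.isUpperSet hx (h2' hs.1.2)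
  · rintro x ⟨s, hs, hx⟩
    have k := hφ _ (h2 hs.1.1) x hx
    have k' := hφ' _ (h2' hs.1.2) x hx
    rw [h3 s hs.1.1] at k
    rw [h3' s hs.1.2, ← e3 hs.2] at k'
    exact k.unique k'

end Corresponds

/-- Every Higman-Thompson representative for `G` restricts to one for `G_M`. -/
theorem exists_corresponds_right {φ : Representative (UnfoldingTree R.1)}
    (hφ : IsHTRepresentative φ) :
    ∃ ψ : Representative (UnfoldingTree R), IsHTRepresentative ψ ∧ Corresponds φ ψ := by
  have aux : ∀ φ : Representative (UnfoldingTree R.1), IsHTRepresentative φ →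
      ∃ f : UnfoldingTree R → UnfoldingTree R,
        ∀ y, embed y ∈ φ.source → embed (f y) = φ (embed y) := by
    intro φ hφ
    rw [isHTRepresentative_iff] at hφ
    have : ∀ y : UnfoldingTree R, ∃ y' : UnfoldingTree R,
        embed y ∈ φ.source → embed y' = φ (embed y) := by
      intro y
      by_cases hy : embed y ∈ φ.source
      -- The image ends where `embed y` does, hence in `M`.
      · obtain ⟨y', h⟩ := exists_embed_eq (x := φ (embed y))
          ((hφ _ hy _ le_rfl).terminus_eq ▸ y.terminus.2)
        exact ⟨y', fun _ => h⟩
      · exact ⟨y, fun h => absurd h hy⟩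
    choose f hf using this
    exact ⟨f, hf⟩
  obtain ⟨f, hf⟩ := aux φ hφ
  obtain ⟨g, hg⟩ := aux φ.symm hφ.symm
  have mf : ∀ y, embed y ∈ φ.source → embed (f y) ∈ φ.target := fun y hy => by
    rw [hf y hy]; exact φ.map_source hy
  have mg : ∀ y, embed y ∈ φ.target → embed (g y) ∈ φ.source := fun y hy => by
    rw [hg y hy]; exact φ.map_target hy
  let ψ : Representative (UnfoldingTree R) := Representative.ofMonotone f g
    φ.source_cofinite.preimage_embed φ.target_cofinite.preimage_embed mf mg
    (fun y hy => embed_injective (by rw [hg _ (mf y hy), hf y hy]; exact φ.left_inv hy))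
    (fun y hy => embed_injective (by rw [hf _ (mg y hy), hg y hy]; exact φ.right_inv hy))
    (fun x hx y hxy => by
      have hy := φ.source_cofinite.isUpperSet (embed_le_embed.2 hxy) hx
      rw [← embed_le_embed, hf x hx, hf y hy]
      exact (φ.le_iff_le _ hx _ hy).2 (embed_le_embed.2 hxy))
    (fun x hx y hxy => by
      have hy := φ.target_cofinite.isUpperSet (embed_le_embed.2 hxy) hx
      rw [← embed_le_embed, hg x hx, hg y hy]
      exact (φ.symm.le_iff_le _ hx _ hy).2 (embed_le_embed.2 hxy))
  refine ⟨ψ, isHTRepresentative_iff.2 fun s hs s' hle => ?_,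
    embed ⁻¹' φ.source, φ.source_cofinite.preimage_embed, subset_rfl, subset_rfl,
    fun y hy => (hf y hy).symm⟩
  refine ParallelExtension.of_embed ?_
  change ParallelExtension (embed s) (embed (f s)) (embed s') (embed (f s'))
  rw [hf s hs, hf s' (φ.source_cofinite.isUpperSet (embed_le_embed.2 hle) hs)]
  exact isHTRepresentative_iff.1 hφ _ hs _ (embed_le_embed.2 hle)

/-- The extension of a Higman-Thompson representative for `G_M` to walks of `G`. -/
theorem exists_extension {ψ : Representative (UnfoldingTree R)} (hψ : IsHTRepresentative ψ) :
    ∃ f : UnfoldingTree R.1 → UnfoldingTree R.1, ∀ s ∈ ψ.source, ∀ x, embed s ≤ x →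
      ParallelExtension (embed s) (embed (ψ s)) x (f x) := by
  rw [isHTRepresentative_iff] at hψ
  -- Two nested prefixes of `x` in the domain prescribe the same value at `x`.
  have step : ∀ s ∈ ψ.source, ∀ s', s ≤ s' → ∀ x u u',
      ParallelExtension (embed s) (embed (ψ s)) x u →
      ParallelExtension (embed s') (embed (ψ s')) x u' → u = u' :=
    fun s hs s' hle x u u' h h' => h.unique ((hψ s hs s' hle).embed.trans h')
  have : ∀ x : UnfoldingTree R.1, ∃ u, ∀ s ∈ ψ.source, embed s ≤ x →
      ParallelExtension (embed s) (embed (ψ s)) x u := by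
    intro x
    by_cases hx : ∃ s ∈ ψ.source, embed s ≤ x
    · obtain ⟨s, hs, hsx⟩ := hx
      obtain ⟨u, hu⟩ := ParallelExtension.exists_of_le
        (hψ s hs s le_rfl).embed.terminus_eq hsx
      refine ⟨u, fun s' hs' hsx' => ?_⟩
      obtain ⟨u', hu'⟩ := ParallelExtension.exists_of_le
        (hψ s' hs' s' le_rfl).embed.terminus_eq hsx'
      have : u = u' := by
        rcases UnfoldingTree.le_total_of_le hsx hsx' with h | h
        · exact step s hs s' (embed_le_embed.1 h) x u u' hu hu'
        · exact (step s' hs' s (embed_le_embed.1 h) x u' u hu' hu).symm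
      rwa [this]
    · exact ⟨x, fun s hs hsx => absurd ⟨s, hs, hsx⟩ hx⟩
  choose f hf using this
  exact ⟨f, fun s hs x => hf x s hs⟩

/-- Every Higman-Thompson representative for `G_M` extends to one for `G`. -/
theorem exists_corresponds_left [Finite V] [∀ a b : V, Finite (a ⟶ b)]
    (hM : ∀ (a : V) (c : Quiver.Path a a), 0 < c.length → ∃ w ∈ M, w ∈ c.vertices)
    {ψ : Representative (UnfoldingTree R)} (hψ : IsHTRepresentative ψ) :
    ∃ φ : Representative (UnfoldingTree R.1), IsHTRepresentative φ ∧ Corresponds φ ψ := by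
  -- The three facts are stated for arbitrary `ψ` so that they also apply to `ψ.symm`.
  have inv : ∀ ψ : Representative (UnfoldingTree R), ∀ f g : UnfoldingTree R.1 → UnfoldingTree R.1,
      (∀ s ∈ ψ.source, ∀ x, embed s ≤ x → ParallelExtension (embed s) (embed (ψ s)) x (f x)) →
      (∀ s ∈ ψ.symm.source, ∀ x, embed s ≤ x →
        ParallelExtension (embed s) (embed (ψ.symm s)) x (g x)) →
      ∀ x ∈ upperEmbed ψ.source, g (f x) = x := by
    rintro ψ f g hf hg x ⟨s, hs, hx⟩
    have h := hf s hs x hx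
    have h' := hg (ψ s) (ψ.map_source hs) (f x) h.symm.le
    have e : ψ.symm (ψ s) = s := ψ.left_inv hs
    rw [e] at h'
    exact (h.symm.unique h').symm
  have maps : ∀ ψ : Representative (UnfoldingTree R), ∀ f : UnfoldingTree R.1 → UnfoldingTree R.1,
      (∀ s ∈ ψ.source, ∀ x, embed s ≤ x → ParallelExtension (embed s) (embed (ψ s)) x (f x)) →
      ∀ x ∈ upperEmbed ψ.source, f x ∈ upperEmbed ψ.target := by
    rintro ψ f hf x ⟨s, hs, hx⟩
    exact ⟨ψ s, ψ.map_source hs, (hf s hs x hx).symm.le⟩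
  have par : ∀ ψ : Representative (UnfoldingTree R), ∀ f : UnfoldingTree R.1 → UnfoldingTree R.1,
      (∀ s ∈ ψ.source, ∀ x, embed s ≤ x → ParallelExtension (embed s) (embed (ψ s)) x (f x)) →
      ∀ x ∈ upperEmbed ψ.source, ∀ y, x ≤ y → ParallelExtension x (f x) y (f y) := by
    rintro ψ f hf x ⟨s, hs, hx⟩ y hxy
    exact (hf s hs x hx).of_le (hf s hs y (hx.trans hxy)) hxy
  obtain ⟨f, hf⟩ := exists_extension hψ
  obtain ⟨g, hg⟩ := exists_extension hψ.symm
  let φ : Representative (UnfoldingTree R.1) := Representative.ofMonotone f g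
    (ψ.source_cofinite.upperEmbed hM) (ψ.target_cofinite.upperEmbed hM)
    (maps ψ f hf) (maps ψ.symm g hg) (inv ψ f g hf hg) (inv ψ.symm g f hg hf)
    (fun x hx y hxy => (par ψ f hf x hx y hxy).symm.le)
    (fun x hx y hxy => (par ψ.symm g hg x hx y hxy).symm.le)
  refine ⟨φ, isHTRepresentative_iff.2 (par ψ f hf), ψ.source, ψ.source_cofinite, subset_rfl,
    fun s hs => ⟨s, hs, le_rfl⟩, fun s hs => ?_⟩
  exact (hf s hs _ le_rfl).unique ((isHTRepresentative_iff.1 hψ s hs s le_rfl).embed)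

/-- Reducing the graph does not change the Higman-Thompson group. -/
theorem nonempty_HT_mulEquiv_reduced [Finite V] [∀ a b : V, Finite (a ⟶ b)]
    (hM : ∀ (a : V) (c : Quiver.Path a a), 0 < c.length → ∃ w ∈ M, w ∈ c.vertices)
    (R : Reduced M) : Nonempty (HT R.1 ≃* HT R) := by
  refine nonempty_mulEquiv_of_correspondence
    -- Only `φ` has to be Higman-Thompson: `equivalent_left` needs this, while `equivalent_right`
    -- holds for all representatives.
    (fun g k => ∃ (φ : Representative (UnfoldingTree R.1)) (ψ : Representative (UnfoldingTree R)),
      IsHTRepresentative φ ∧ AlmostAut.mk φ = g.1 ∧ AlmostAut.mk ψ = k.1 ∧ Corresponds φ ψ)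
    ?_ ?_ ?_ ?_ ?_
  · rintro ⟨_, φ, hφ, rfl⟩
    obtain ⟨ψ, hψ, h⟩ := exists_corresponds_right hφ
    exact ⟨⟨AlmostAut.mk ψ, ψ, hψ, rfl⟩, φ, ψ, hφ, rfl, rfl, h⟩
  · rintro ⟨_, ψ, hψ, rfl⟩
    obtain ⟨φ, hφ, h⟩ := exists_corresponds_left hM hψ
    exact ⟨⟨AlmostAut.mk φ, φ, hφ, rfl⟩, φ, ψ, hφ, rfl, rfl, h⟩
  · rintro g k k' ⟨φ, ψ, -, h1, h2, h3⟩ ⟨φ', ψ', -, h1', h2', h3'⟩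
    refine Subtype.ext (h2.symm.trans (Eq.trans ?_ h2'))
    exact Quotient.sound (h3.equivalent_right h3' (Quotient.exact (h1.trans h1'.symm)))
  · rintro g g' k ⟨φ, ψ, h0, h1, h2, h3⟩ ⟨φ', ψ', h0', h1', h2', h3'⟩
    refine Subtype.ext (h1.symm.trans (Eq.trans ?_ h1'))
    exact Quotient.sound (h3.equivalent_left hM h0 h0' h3' (Quotient.exact (h2.trans h2'.symm)))
  · rintro g g' k k' ⟨φ, ψ, h0, h1, h2, h3⟩ ⟨φ', ψ', h0', h1', h2', h3'⟩
    refine ⟨φ.comp φ', ψ.comp ψ', h0.comp h0', ?_, ?_, h3.comp h3'⟩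
    · change _ = g.1 * g'.1
      rw [← h1, ← h1']
      rfl
    · change _ = k.1 * k'.1
      rw [← h2, ← h2']
      rfl

end Graph

end HigmanThompson

theorem corollary1 {V : Type u} [Quiver.{v} V] [Finite V] [∀ a b : V, Finite (a ⟶ b)]
    (R : V) (hR : HigmanThompson.IsRoot R) (hsink : ∀ a : V, ¬ HigmanThompson.IsSink a)
    (M : Set V) (hRM : R ∈ M)
    (hM : ∀ (a : V) (c : Quiver.Path a a), 0 < c.length → ∃ w ∈ M, w ∈ c.vertices) :
    HigmanThompson.IsRoot (V := HigmanThompson.Reduced M) ⟨R, hRM⟩ ∧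
      Nonempty (HigmanThompson.HT R ≃*
        HigmanThompson.HT (V := HigmanThompson.Reduced M) ⟨R, hRM⟩) :=
  ⟨HigmanThompson.isRoot_reduced (R := ⟨R, hRM⟩) hR,
    HigmanThompson.nonempty_HT_mulEquiv_reduced hM ⟨R, hRM⟩⟩
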